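/- Let $\mathbb H=\{s\in\mathbb C:\operatorname{Re}s>-\tfrac12\}$, so that for every $s\in\mathbb H$ the function $x^s$ belongs to $L^2[0,1]$ (complex-valued, Lebesgue measure), and let $c,\beta:\mathbb H\to\mathbb C$ be arbitrary functions. Say that a bounded linear operator $T$ on $L^2[0,1]$ is *given by* $x^s\mapsto c(s)\,x^{\beta(s)}$ if $T(x^s)=c(s)\,x^{\beta(s)}$ (almost everywhere on $[0,1]$) for every $s\in\mathbb H$. Consider the condition: $(\ast)$ $\beta$ is an automorphism of $\mathbb H$ (a holomorphic bijection of $\mathbb H$ onto itself with holomorphic inverse), and there is a real number $\theta$ such that $$c(s)=\frac{e^{i\theta}}{\sqrt{1+2\operatorname{Re}\beta(0)}}\;\frac{1+\overline{\beta(0)}+\beta(s)}{1+s}\qquad\text{for all } s\in\mathbb H .$$ Then the formula $x^s\mapsto c(s)\,x^{\beta(s)}$ defines a unitary operator on $L^2[0,1]$ if and only if $(\ast)$ holds. That is, there exists a unitary operator on $L^2[0,1]$ given by $x^s\mapsto c(s)\,x^{\beta(s)}$ if and only if $(\ast)$ holds; and any bounded linear operator on $L^2[0,1]$ given by $x^s\mapsto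 c(s)\,x^{\beta(s)}$ is unitary if and only if $(\ast)$ holds. -/

import Mathlib

open MeasureTheory Set

noncomputable section

/-- The open half-plane of complex numbers with real part greater than `-1/2`. -/
def halfPlane : Set ℂ := {s : ℂ | -(1 / 2 : ℝ) < s.re}

/-- Lebesgue measure on the interval `[0, 1]`. -/
abbrev unitIntervalMeasure : Measure ℝ := volume.restrict (Icc (0 : ℝ) 1)

/-- The complex Hilbert space `L²[0,1]`. -/
abbrev L2Unit : Type := Lp ℂ 2 unitIntervalMeasure

/-- The function `x ↦ x ^ s`, for a complex exponent `s`. -/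
def monomialFun (s : ℂ) : ℝ → ℂ := fun x => (x : ℂ) ^ s

/-- For `s` in the half-plane, the function `x ^ s` is square integrable on `[0,1]`. -/
theorem memLp_monomialFun {s : ℂ} (hs : s ∈ halfPlane) :
    MemLp (monomialFun s) 2 unitIntervalMeasure := by
  have hs' : -(1 / 2 : ℝ) < s.re := hs
  have hmeas : Measurable (monomialFun s) := by
    unfold monomialFun
    fun_prop
  rw [memLp_two_iff_integrable_sq_norm hmeas.aestronglyMeasurable]
  have h1 : IntervalIntegrable (fun x : ℝ => x ^ (2 * s.re)) volume 0 1 :=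
    intervalIntegral.intervalIntegrable_rpow' (by linarith)
  rw [intervalIntegrable_iff_integrableOn_Ioc_of_le zero_le_one] at h1
  change IntegrableOn (fun x => ‖monomialFun s x‖ ^ 2) (Icc 0 1) volume
  rw [integrableOn_Icc_iff_integrableOn_Ioc]
  refine h1.congr_fun (fun x hx => ?_) measurableSet_Ioc
  have hx0 : 0 < x := hx.1
  simp only [monomialFun]
  rw [Complex.norm_cpow_eq_rpow_re_of_pos hx0, mul_comm, Real.rpow_mul hx0.le]
  norm_num

/-- The monomial `x ^ s` as an element of `L²[0,1]`, for `s` in the half-plane. -/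
def monomialL2 (s : ℂ) (hs : s ∈ halfPlane) : L2Unit :=
  (memLp_monomialFun hs).toLp (monomialFun s)

/-- The bounded operator `T` on `L²[0,1]` acts by `T : x ^ s ↦ c(s) x ^ β(s)`, for every `s` in
the half-plane (equality of functions almost everywhere on `[0,1]`). -/
def ActsOnMonomials (T : L2Unit →L[ℂ] L2Unit) (c β : ℂ → ℂ) : Prop :=
  ∀ (s : ℂ) (hs : s ∈ halfPlane),
    (T (monomialL2 s hs) : ℝ → ℂ) =ᵐ[unitIntervalMeasure] fun x => c s * monomialFun (β s) x

/-- `β` restricts to an automorphism of the half-plane: a holomorphic self-map with a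
holomorphic inverse. -/
def IsHalfPlaneAutomorphism (β : ℂ → ℂ) : Prop :=
  DifferentiableOn ℂ β halfPlane ∧ MapsTo β halfPlane halfPlane ∧
    ∃ γ : ℂ → ℂ, DifferentiableOn ℂ γ halfPlane ∧ MapsTo γ halfPlane halfPlane ∧
      InvOn γ β halfPlane halfPlane

/-- The formula for the multiplier: for some real `θ` and every `s` in the half-plane,
`c(s) = (exp(iθ) / √(1 + 2 Re β(0))) * (1 + conj (β(0)) + β(s)) / (1 + s)`. -/
def IsUnitaryMultiplier (c β : ℂ → ℂ) : Prop :=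
  ∃ θ : ℝ, ∀ s ∈ halfPlane,
    c s = Complex.exp (θ * Complex.I) / (Real.sqrt (1 + 2 * (β 0).re) : ℂ) *
      ((1 + (starRingEnd ℂ) (β 0) + β s) / (1 + s))

end

noncomputable section

open ComplexConjugate

/-! The monomials span a dense subspace and have Gram kernel `1 / (1 + conj s + t)`, so everything
is read off the identity `PreservesGram`, which any unitary operator given by the formula satisfies.
Its row `s = 0` yields the formula for `c`. Substituting that back
(`IsUnitaryMultiplier.preservesGram_iff`) leaves, with `φ_b = halfPlaneToDisc b` and `b = β 0`, the
condition `conj (φ_b (β s)) * φ_b (β t) = conj (φ_0 s) * φ_0 t`. Fixing one variable makes `φ_b ∘ β`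
a unimodular multiple of `φ_0`, so `β` is an automorphism, with no regularity assumed beforehand.
Conversely, the Schwarz lemma puts every automorphism in this form. The Gram matrix is then
preserved, and the resulting isometry of the span extends to a unitary operator because `β` is onto
and `c` has no zeros. -/

/-! ### Monomials in `L²[0,1]` and their Gram matrix -/

theorem zero_mem_halfPlane : (0 : ℂ) ∈ halfPlane := by
  simp [halfPlane]

theorem natCast_mem_halfPlane (n : ℕ) : (n : ℂ) ∈ halfPlane := by
  have : (0 : ℝ) ≤ n := n.cast_nonneg
  change -(1 / 2 : ℝ) < (n : ℂ).re
  rw [Complex.natCast_re]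
  linarith

theorem one_add_conj_add_ne_zero {s t : ℂ} (hs : s ∈ halfPlane) (ht : t ∈ halfPlane) :
    1 + conj s + t ≠ 0 := by
  intro h
  have h' := congrArg Complex.re h
  have h1 : -(1 / 2 : ℝ) < s.re := hs
  have h2 : -(1 / 2 : ℝ) < t.re := ht
  simp at h'
  linarith

theorem one_add_ne_zero_of_mem_halfPlane {s : ℂ} (hs : s ∈ halfPlane) : 1 + s ≠ 0 := by
  simpa using one_add_conj_add_ne_zero zero_mem_halfPlane hs

/-- Since `β` is an arbitrary function, this is what forces its values into the half-plane. -/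
theorem mem_halfPlane_of_memLp {s : ℂ} (h : MemLp (monomialFun s) 2 unitIntervalMeasure) :
    s ∈ halfPlane := by
  rw [memLp_two_iff_integrable_sq_norm h.1] at h
  have h2 : IntegrableOn (fun x => ‖monomialFun s x‖ ^ 2) (Ioo 0 1) volume :=
    IntegrableOn.mono_set (t := Icc (0 : ℝ) 1) h Ioo_subset_Icc_self
  have h3 : IntegrableOn (fun x : ℝ => x ^ (2 * s.re)) (Ioo 0 1) volume := by
    refine h2.congr_fun (fun x hx => ?_) measurableSet_Ioo
    simp only [monomialFun]
    rw [Complex.norm_cpow_eq_rpow_re_of_pos hx.1, mul_comm 2, Real.rpow_mul hx.1.le]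
    norm_num
  rw [intervalIntegral.integrableOn_Ioo_rpow_iff zero_lt_one] at h3
  change -(1 / 2 : ℝ) < s.re
  linarith

theorem coeFn_monomialL2 {s : ℂ} (hs : s ∈ halfPlane) :
    (monomialL2 s hs : ℝ → ℂ) =ᵐ[unitIntervalMeasure] monomialFun s :=
  MemLp.coeFn_toLp _

theorem inner_monomialL2 {s t : ℂ} (hs : s ∈ halfPlane) (ht : t ∈ halfPlane) :
    inner ℂ (monomialL2 s hs) (monomialL2 t ht) = 1 / (1 + conj s + t) := by
  have h1 : inner ℂ (monomialL2 s hs) (monomialL2 t ht)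
      = ∫ x in Icc (0 : ℝ) 1, (x : ℂ) ^ (conj s + t) := by
    rw [L2.inner_def]
    have h0 : ∀ᵐ x ∂unitIntervalMeasure, x ≠ 0 :=
      ae_restrict_of_ae (Measure.ae_ne volume 0)
    have hI : ∀ᵐ x ∂unitIntervalMeasure, x ∈ Icc (0 : ℝ) 1 :=
      ae_restrict_mem measurableSet_Icc
    refine integral_congr_ae ?_
    filter_upwards [coeFn_monomialL2 hs, coeFn_monomialL2 ht, h0, hI] with x hxs hxt hx0 hxI
    have hx : (x : ℂ) ≠ 0 := by exact_mod_cast hx0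
    -- Conjugation commutes with the principal power only off the negative axis.
    have harg : (x : ℂ).arg ≠ Real.pi := by
      rw [Complex.arg_ofReal_of_nonneg hxI.1]
      exact Real.pi_pos.ne
    rw [hxs, hxt, RCLike.inner_apply, Complex.cpow_add _ _ hx, monomialFun, monomialFun,
      Complex.cpow_conj _ _ harg, Complex.conj_ofReal, mul_comm]
  have h2 : -(1 / 2 : ℝ) < s.re := hs
  have h3 : -(1 / 2 : ℝ) < t.re := ht
  have h4 : conj s + t + 1 = 1 + conj s + t := by ring
  have h5 := one_add_conj_add_ne_zero hs ht
  rw [h1, integral_Icc_eq_integral_Ioc, ← intervalIntegral.integral_of_le zero_le_one,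
    integral_cpow (Or.inl (by simp; linarith)), h4]
  simp [h5]

theorem monomialL2_ne_zero {s : ℂ} (hs : s ∈ halfPlane) : monomialL2 s hs ≠ 0 := by
  intro h
  have h1 := inner_monomialL2 hs hs
  rw [h, inner_zero_left] at h1
  exact one_div_ne_zero (one_add_conj_add_ne_zero hs hs) h1.symm

/-! ### Density of the span of the monomials -/

theorem norm_sub_le_of_forall_Icc {f g : ℝ → ℂ} (hf : MemLp f 2 unitIntervalMeasure)
    (hg : MemLp g 2 unitIntervalMeasure) {ε : ℝ} (hε : 0 ≤ ε)
    (h : ∀ x ∈ Icc (0 : ℝ) 1, ‖f x - g x‖ ≤ ε) : ‖hf.toLp f - hg.toLp g‖ ≤ ε := by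
  have h1 : ∀ᵐ x ∂unitIntervalMeasure, ‖(hf.toLp f - hg.toLp g : L2Unit) x‖ ≤ ε := by
    filter_upwards [Lp.coeFn_sub (hf.toLp f) (hg.toLp g), hf.coeFn_toLp, hg.coeFn_toLp,
      ae_restrict_mem measurableSet_Icc] with x h1 h2 h3 h4
    rw [h1, Pi.sub_apply, h2, h3]
    exact h x h4
  simpa [measureUnivNNReal] using Lp.norm_le_of_ae_bound hε h1

theorem memLp_polynomial (p : Polynomial ℂ) :
    MemLp (fun x : ℝ => p.eval (x : ℂ)) 2 unitIntervalMeasure := by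
  have hc : Continuous fun x : ℝ => p.eval (x : ℂ) := p.continuous.comp Complex.continuous_ofReal
  obtain ⟨C, hC⟩ := isCompact_Icc.exists_bound_of_continuousOn (s := Icc (0 : ℝ) 1) hc.continuousOn
  refine MemLp.of_bound hc.aestronglyMeasurable C ?_
  filter_upwards [ae_restrict_mem measurableSet_Icc] with x hx using hC x hx

theorem toLp_polynomial_mem_span (p : Polynomial ℂ) :
    (memLp_polynomial p).toLp _ ∈
      Submodule.span ℂ (range fun s : halfPlane => monomialL2 s s.2) := by
  induction p using Polynomial.induction_on' with
  | add p q hp hq =>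
    have h : (memLp_polynomial (p + q)).toLp _
        = (memLp_polynomial p).toLp _ + (memLp_polynomial q).toLp _ := by
      rw [← MemLp.toLp_add]
      congr 1
      ext x
      simp
    rw [h]
    exact Submodule.add_mem _ hp hq
  | monomial n a =>
    have h : (memLp_polynomial (Polynomial.monomial n a)).toLp _
        = a • monomialL2 n (natCast_mem_halfPlane n) := by
      rw [monomialL2, ← MemLp.toLp_const_smul]
      congr 1
      ext x
      simp [monomialFun]
    rw [h]
    exact Submodule.smul_mem _ _
      (Submodule.subset_span ⟨⟨n, natCast_mem_halfPlane n⟩, rfl⟩)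

theorem exists_complex_polynomial_near_of_continuousOn {a b : ℝ} {f : ℝ → ℂ}
    (hf : ContinuousOn f (Icc a b)) {ε : ℝ} (hε : 0 < ε) :
    ∃ p : Polynomial ℂ, ∀ x ∈ Icc a b, ‖p.eval (x : ℂ) - f x‖ < ε := by
  obtain ⟨p, hp⟩ := exists_polynomial_near_of_continuousOn a b (fun x => (f x).re)
    (Complex.continuous_re.comp_continuousOn hf) (ε / 2) (half_pos hε)
  obtain ⟨q, hq⟩ := exists_polynomial_near_of_continuousOn a b (fun x => (f x).im)
    (Complex.continuous_im.comp_continuousOn hf) (ε / 2) (half_pos hε)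
  refine ⟨p.map (algebraMap ℝ ℂ) + Polynomial.C Complex.I * q.map (algebraMap ℝ ℂ),
    fun x hx => ?_⟩
  have hre : ∀ r : Polynomial ℝ, (r.map (algebraMap ℝ ℂ)).eval (x : ℂ) = (r.eval x : ℝ) :=
    fun r => Polynomial.eval_map_apply (algebraMap ℝ ℂ) x
  rw [Polynomial.eval_add, Polynomial.eval_mul, Polynomial.eval_C, hre, hre]
  refine (Complex.norm_le_abs_re_add_abs_im _).trans_lt ?_
  have h1 := hp x hx
  have h2 := hq x hx
  simp
  linarith

/-- Natural exponents already suffice: continuous functions are dense in `L²`, and Weierstrass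
approximates them uniformly by polynomials. -/
theorem topologicalClosure_span_monomialL2 :
    (Submodule.span ℂ (range fun s : halfPlane => monomialL2 s s.2)).topologicalClosure = ⊤ := by
  rw [Submodule.eq_top_iff']
  refine fun f => (BoundedContinuousFunction.toLp_denseRange ℂ unitIntervalMeasure ℂ
    (by norm_num : (2 : ENNReal) ≠ ⊤)).induction_on f (Submodule.isClosed_topologicalClosure _)
    fun g => ?_
  rw [← SetLike.mem_coe, Submodule.topologicalClosure_coe, Metric.mem_closure_iff]
  intro ε hε
  obtain ⟨p, hp⟩ := exists_complex_polynomial_near_of_continuousOn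
    (a := 0) (b := 1) g.continuous.continuousOn (half_pos hε)
  refine ⟨_, toLp_polynomial_mem_span p, ?_⟩
  rw [dist_comm, dist_eq_norm]
  refine (norm_sub_le_of_forall_Icc (memLp_polynomial p) (g := g)
    (MemLp.of_bound g.continuous.aestronglyMeasurable ‖g‖ (.of_forall g.norm_coe_le_norm))
    (half_pos hε).le
    fun x hx => (hp x hx).le).trans_lt (half_lt_self hε)

/-! ### Möbius maps between the half-plane and the disc -/

/-- The Möbius map `s ↦ (s - b) / (1 + conj b + s)` of the half-plane onto the unit disc that
vanishes at `b`. -/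
def halfPlaneToDisc (b s : ℂ) : ℂ := (s - b) / (1 + conj b + s)

/-- The inverse of `halfPlaneToDisc b`. -/
def discToHalfPlane (b z : ℂ) : ℂ := (b + (1 + conj b) * z) / (1 - z)

theorem one_sub_ne_zero_of_norm_lt_one {z : ℂ} (hz : ‖z‖ < 1) : 1 - z ≠ 0 := by
  intro h
  rw [← sub_eq_zero.1 h] at hz
  simp at hz

/-- This carries the Gram kernel of the half-plane to the Szegő kernel of the disc, up to factors in
`s` and `t` separately; those factors are the ones that appear in the multiplier. -/
theorem one_sub_conj_halfPlaneToDisc_mul {b s t : ℂ} (hb : b ∈ halfPlane) (hs : s ∈ halfPlane)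
    (ht : t ∈ halfPlane) :
    1 - conj (halfPlaneToDisc b s) * halfPlaneToDisc b t =
      (1 + conj b + b) * (1 + conj s + t) / (conj (1 + conj b + s) * (1 + conj b + t)) := by
  have h1 : 1 + conj b + t ≠ 0 := one_add_conj_add_ne_zero hb ht
  have h2 : conj (1 + conj b + s) ≠ 0 :=
    (map_ne_zero _).2 (one_add_conj_add_ne_zero hb hs)
  rw [halfPlaneToDisc, halfPlaneToDisc, map_div₀, eq_div_iff (mul_ne_zero h2 h1)]
  field_simp
  simp
  ring

theorem norm_halfPlaneToDisc_lt_one {b s : ℂ} (hb : b ∈ halfPlane) (hs : s ∈ halfPlane) :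
    ‖halfPlaneToDisc b s‖ < 1 := by
  have hb' : -(1 / 2 : ℝ) < b.re := hb
  have hs' : -(1 / 2 : ℝ) < s.re := hs
  have h1 : 1 + conj b + s ≠ 0 := one_add_conj_add_ne_zero hb hs
  rw [halfPlaneToDisc, norm_div, div_lt_one (norm_pos_iff.2 h1),
    ← sq_lt_sq₀ (norm_nonneg _) (norm_nonneg _), ← Complex.normSq_eq_norm_sq,
    ← Complex.normSq_eq_norm_sq, Complex.normSq_apply, Complex.normSq_apply]
  simp
  nlinarith [mul_pos (by linarith : 0 < 1 + 2 * b.re) (by linarith : 0 < 1 + 2 * s.re)]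

theorem discToHalfPlane_mem {b z : ℂ} (hb : b ∈ halfPlane) (hz : ‖z‖ < 1) :
    discToHalfPlane b z ∈ halfPlane := by
  have hb' : -(1 / 2 : ℝ) < b.re := hb
  have h1 := one_sub_ne_zero_of_norm_lt_one hz
  have h2 : discToHalfPlane b z + conj (discToHalfPlane b z) + 1 =
      ((1 + 2 * b.re) * (1 - Complex.normSq z) / Complex.normSq (1 - z) : ℝ) := by
    have h3 : (1 : ℂ) - conj z ≠ 0 := by
      simpa using (map_ne_zero (starRingEnd ℂ)).2 h1
    have h4 : (2 * b.re : ℂ) = b + conj b := by rw [Complex.add_conj]; push_cast; ring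
    push_cast
    rw [Complex.normSq_eq_conj_mul_self, Complex.normSq_eq_conj_mul_self, h4, discToHalfPlane]
    simp
    field_simp
    ring
  rw [Complex.add_conj, ← Complex.ofReal_one, ← Complex.ofReal_add, Complex.ofReal_inj,
    Complex.ofReal_one] at h2
  have h5 : Complex.normSq z < 1 := by
    rw [Complex.normSq_eq_norm_sq]
    nlinarith [norm_nonneg z]
  have h6 : 0 < (1 + 2 * b.re) * (1 - Complex.normSq z) / Complex.normSq (1 - z) :=
    div_pos (mul_pos (by linarith) (by linarith)) (Complex.normSq_pos.2 h1)
  change -(1 / 2 : ℝ) < (discToHalfPlane b z).re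
  linarith

theorem halfPlaneToDisc_discToHalfPlane {b z : ℂ} (hb : b ∈ halfPlane) (hz : ‖z‖ < 1) :
    halfPlaneToDisc b (discToHalfPlane b z) = z := by
  have h1 := one_sub_ne_zero_of_norm_lt_one hz
  have h2 : 1 + conj b + discToHalfPlane b z ≠ 0 :=
    one_add_conj_add_ne_zero hb (discToHalfPlane_mem hb hz)
  rw [halfPlaneToDisc, div_eq_iff h2, discToHalfPlane]
  field_simp
  ring

theorem discToHalfPlane_halfPlaneToDisc {b s : ℂ} (hb : b ∈ halfPlane) (hs : s ∈ halfPlane) :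
    discToHalfPlane b (halfPlaneToDisc b s) = s := by
  have h1 := one_sub_ne_zero_of_norm_lt_one (norm_halfPlaneToDisc_lt_one hb hs)
  have h2 : 1 + conj b + s ≠ 0 := one_add_conj_add_ne_zero hb hs
  rw [discToHalfPlane, div_eq_iff h1, halfPlaneToDisc]
  field_simp
  ring

theorem differentiableOn_halfPlaneToDisc {b : ℂ} (hb : b ∈ halfPlane) :
    DifferentiableOn ℂ (halfPlaneToDisc b) halfPlane := by
  unfold halfPlaneToDisc
  exact (by fun_prop : DifferentiableOn ℂ (fun s => s - b) halfPlane).div (by fun_prop)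
    fun s hs => one_add_conj_add_ne_zero hb hs

theorem differentiableOn_discToHalfPlane (b : ℂ) :
    DifferentiableOn ℂ (discToHalfPlane b) (Metric.ball 0 1) := by
  unfold discToHalfPlane
  exact (by fun_prop : DifferentiableOn ℂ (fun z => b + (1 + conj b) * z) _).div (by fun_prop)
    fun z hz => one_sub_ne_zero_of_norm_lt_one (mem_ball_zero_iff.1 hz)

theorem mapsTo_halfPlaneToDisc {b : ℂ} (hb : b ∈ halfPlane) :
    MapsTo (halfPlaneToDisc b) halfPlane (Metric.ball 0 1) :=
  fun _ hs => mem_ball_zero_iff.2 (norm_halfPlaneToDisc_lt_one hb hs)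

theorem mapsTo_discToHalfPlane {b : ℂ} (hb : b ∈ halfPlane) :
    MapsTo (discToHalfPlane b) (Metric.ball 0 1) halfPlane :=
  fun _ hz => discToHalfPlane_mem hb (mem_ball_zero_iff.1 hz)

/-! ### Automorphisms as rotations of the disc -/

/-- A holomorphic self-map of the unit disc that fixes the origin and has a holomorphic inverse
is a rotation. -/
theorem exists_eq_mul_of_disc_automorphism {f g : ℂ → ℂ}
    (hf : DifferentiableOn ℂ f (Metric.ball 0 1)) (hg : DifferentiableOn ℂ g (Metric.ball 0 1))
    (hfm : MapsTo f (Metric.ball 0 1) (Metric.ball 0 1))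
    (hgm : MapsTo g (Metric.ball 0 1) (Metric.ball 0 1))
    (hgf : LeftInvOn g f (Metric.ball 0 1)) (hf0 : f 0 = 0) :
    ∃ l : ℂ, ‖l‖ = 1 ∧ ∀ z ∈ Metric.ball (0 : ℂ) 1, f z = l * z := by
  have h0 : (0 : ℂ) ∈ Metric.ball (0 : ℂ) 1 := Metric.mem_ball_self one_pos
  have hg0 : g 0 = 0 := by simpa [hf0] using hgf h0
  have hnorm : ∀ z ∈ Metric.ball (0 : ℂ) 1, ‖f z‖ = ‖z‖ := fun z hz => by
    refine le_antisymm
      (Complex.norm_le_norm_of_mapsTo_ball hf (hfm.mono_right Metric.ball_subset_closedBall) hf0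
        (mem_ball_zero_iff.1 hz)) ?_
    have := Complex.norm_le_norm_of_mapsTo_ball hg
      (hgm.mono_right Metric.ball_subset_closedBall) hg0 (mem_ball_zero_iff.1 (hfm hz))
    rwa [hgf hz] at this
  have hw : (1 / 2 : ℂ) ∈ Metric.ball (0 : ℂ) 1 := by
    rw [mem_ball_zero_iff]
    norm_num
  -- Schwarz for `f` and for `g` gives `‖f z‖ = ‖z‖`. Equality at one nonzero point, here `1 / 2`,
  -- is the extremal case and forces linearity.
  have hd : ‖dslope f 0 (1 / 2)‖ = 1 / 1 := by
    rw [dslope_of_ne _ (by norm_num), slope_def_field, hf0, sub_zero, sub_zero, norm_div,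
      hnorm _ hw]
    norm_num
  obtain ⟨l, hl, hfl⟩ := Complex.affine_of_mapsTo_ball_of_exists_norm_dslope_eq_div' hf
    (by rw [hf0]; exact hfm.mono_right Metric.ball_subset_closedBall) ⟨_, hw, hd⟩
  refine ⟨l, by simpa using hl, fun z hz => ?_⟩
  have := hfl hz
  simpa [hf0, mul_comm] using this

theorem IsHalfPlaneAutomorphism.exists_halfPlaneToDisc_eq {β : ℂ → ℂ}
    (hβ : IsHalfPlaneAutomorphism β) :
    ∃ l : ℂ, ‖l‖ = 1 ∧
      ∀ s ∈ halfPlane, halfPlaneToDisc (β 0) (β s) = l * halfPlaneToDisc 0 s := by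
  obtain ⟨hd, hm, γ, hγd, hγm, hl, hr⟩ := hβ
  have h0 := zero_mem_halfPlane
  have hb := hm h0
  have d0 := mapsTo_discToHalfPlane h0
  have db := mapsTo_discToHalfPlane hb
  obtain ⟨l, hl1, hl2⟩ := exists_eq_mul_of_disc_automorphism
    (f := halfPlaneToDisc (β 0) ∘ β ∘ discToHalfPlane 0)
    (g := halfPlaneToDisc 0 ∘ γ ∘ discToHalfPlane (β 0))
    ((differentiableOn_halfPlaneToDisc hb).comp
      (hd.comp (differentiableOn_discToHalfPlane 0) d0) (hm.comp d0))
    ((differentiableOn_halfPlaneToDisc h0).comp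
      (hγd.comp (differentiableOn_discToHalfPlane _) db) (hγm.comp db))
    ((mapsTo_halfPlaneToDisc hb).comp (hm.comp d0))
    ((mapsTo_halfPlaneToDisc h0).comp (hγm.comp db))
    (fun z hz => by
      simp only [Function.comp_apply]
      rw [discToHalfPlane_halfPlaneToDisc hb (hm (d0 hz)), hl (d0 hz),
        halfPlaneToDisc_discToHalfPlane h0 (mem_ball_zero_iff.1 hz)])
    (by simp [discToHalfPlane, halfPlaneToDisc])
  refine ⟨l, hl1, fun s hs => ?_⟩
  simpa [discToHalfPlane_halfPlaneToDisc h0 hs] using hl2 _ (mapsTo_halfPlaneToDisc h0 hs)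

theorem isHalfPlaneAutomorphism_of_halfPlaneToDisc_eq {β : ℂ → ℂ} {l : ℂ} (hl : ‖l‖ = 1)
    (hm : MapsTo β halfPlane halfPlane)
    (h : ∀ s ∈ halfPlane, halfPlaneToDisc (β 0) (β s) = l * halfPlaneToDisc 0 s) :
    IsHalfPlaneAutomorphism β := by
  have h0 := zero_mem_halfPlane
  have hb := hm h0
  have hl0 : l ≠ 0 := norm_ne_zero_iff.1 (by simp [hl])
  have rot : MapsTo (fun z => l * z) (Metric.ball 0 1) (Metric.ball 0 1) := fun z hz => by
    simpa [hl] using hz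
  have rot' : MapsTo (fun z => l⁻¹ * z) (Metric.ball 0 1) (Metric.ball 0 1) := fun z hz => by
    simpa [hl] using hz
  have hβ : ∀ s ∈ halfPlane, β s = discToHalfPlane (β 0) (l * halfPlaneToDisc 0 s) :=
    fun s hs => by rw [← h s hs, discToHalfPlane_halfPlaneToDisc hb (hm hs)]
  have m1 := rot.comp (mapsTo_halfPlaneToDisc h0)
  have m2 := rot'.comp (mapsTo_halfPlaneToDisc hb)
  refine ⟨?_, hm, fun s => discToHalfPlane 0 (l⁻¹ * halfPlaneToDisc (β 0) s), ?_, ?_, ?_, ?_⟩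
  · exact ((differentiableOn_discToHalfPlane _).comp
      ((differentiableOn_halfPlaneToDisc h0).const_mul l) m1).congr hβ
  · exact (differentiableOn_discToHalfPlane 0).comp
      ((differentiableOn_halfPlaneToDisc hb).const_mul l⁻¹) m2
  · exact (mapsTo_discToHalfPlane h0).comp m2
  · intro s hs
    simp only
    rw [h s hs, inv_mul_cancel_left₀ hl0, discToHalfPlane_halfPlaneToDisc h0 hs]
  · intro s hs
    have hz : l⁻¹ * halfPlaneToDisc (β 0) s ∈ Metric.ball (0 : ℂ) 1 := m2 hs
    simp only
    rw [hβ _ (mapsTo_discToHalfPlane h0 hz),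
      halfPlaneToDisc_discToHalfPlane h0 (mem_ball_zero_iff.1 hz),
      mul_inv_cancel_left₀ hl0, discToHalfPlane_halfPlaneToDisc hb hs]

/-! ### The Gram identity as a condition on `c` and `β` -/

theorem one_add_conj_add_self (b : ℂ) : 1 + conj b + b = ((1 + 2 * b.re : ℝ) : ℂ) := by
  rw [add_assoc, add_comm (conj b), Complex.add_conj]
  push_cast
  ring

theorem one_add_two_mul_re_pos {b : ℂ} (hb : b ∈ halfPlane) : 0 < 1 + 2 * b.re := by
  have hb' : -(1 / 2 : ℝ) < b.re := hb
  linarith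

/-- The weights `c` and the exponents `β` preserve the Gram matrix of the monomials. -/
def PreservesGram (c β : ℂ → ℂ) : Prop :=
  ∀ s ∈ halfPlane, ∀ t ∈ halfPlane,
    conj (c s) * c t * (1 + conj s + t) = 1 + conj (β s) + β t

theorem PreservesGram.isUnitaryMultiplier {c β : ℂ → ℂ} (h : PreservesGram c β)
    (hm : MapsTo β halfPlane halfPlane) : IsUnitaryMultiplier c β := by
  have h0 := zero_mem_halfPlane
  have hpos := one_add_two_mul_re_pos (hm h0)
  have hc0 : conj (c 0) * c 0 = ((1 + 2 * (β 0).re : ℝ) : ℂ) := by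
    rw [← one_add_conj_add_self, ← h 0 h0 0 h0]
    simp
  have hsq : ‖c 0‖ ^ 2 = 1 + 2 * (β 0).re := by
    rw [Complex.conj_mul'] at hc0
    exact_mod_cast hc0
  have hn : ‖c 0‖ = Real.sqrt (1 + 2 * (β 0).re) := by
    rw [← hsq, Real.sqrt_sq (norm_nonneg _)]
  have hn0 : (‖c 0‖ : ℂ) ≠ 0 := by
    rw [hn]
    exact_mod_cast (Real.sqrt_pos.2 hpos).ne'
  -- The identity at `(0, 0)` fixes the modulus of `c 0`; its argument is the free phase.
  refine ⟨(c 0).arg, fun s hs => ?_⟩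
  have h1 := h 0 h0 s hs
  have hs1 := one_add_ne_zero_of_mem_halfPlane hs
  rw [← h1, ← hn]
  have h2 : (‖c 0‖ : ℂ) * Complex.exp ((c 0).arg * Complex.I) = c 0 :=
    Complex.norm_mul_exp_arg_mul_I _
  have h3 : conj (c 0) * c 0 = (‖c 0‖ : ℂ) ^ 2 := Complex.conj_mul' _
  have h4 : Complex.exp ((c 0).arg * Complex.I) = c 0 / ‖c 0‖ := by
    rw [eq_div_iff hn0, mul_comm, h2]
  rw [h4, map_zero, add_zero]
  field_simp
  rw [← h3]
  ring

theorem IsUnitaryMultiplier.conj_mul {c β : ℂ → ℂ} (h : IsUnitaryMultiplier c β)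
    (hb : β 0 ∈ halfPlane) {s t : ℂ} (hs : s ∈ halfPlane) (ht : t ∈ halfPlane) :
    conj (c s) * c t = conj (1 + conj (β 0) + β s) * (1 + conj (β 0) + β t) /
      ((1 + conj (β 0) + β 0) * (conj (1 + s) * (1 + t))) := by
  obtain ⟨θ, hθ⟩ := h
  have hpos := one_add_two_mul_re_pos hb
  have he : conj (Complex.exp (θ * Complex.I)) * Complex.exp (θ * Complex.I) = 1 := by
    rw [Complex.conj_mul', Complex.norm_exp_ofReal_mul_I]
    simp
  have hr : (Real.sqrt (1 + 2 * (β 0).re) : ℂ) * Real.sqrt (1 + 2 * (β 0).re) =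
      1 + conj (β 0) + β 0 := by
    rw [one_add_conj_add_self, ← Complex.ofReal_mul, Real.mul_self_sqrt hpos.le]
  rw [hθ s hs, hθ t ht, map_mul, map_div₀, map_div₀, Complex.conj_ofReal, ← hr]
  calc _ = (conj (Complex.exp (θ * Complex.I)) * Complex.exp (θ * Complex.I)) * _ := by
        rw [mul_mul_mul_comm, div_mul_div_comm, div_mul_div_comm, div_mul_div_comm,
          mul_div_assoc, mul_div_assoc]
    _ = _ := by rw [he, one_mul, mul_div_assoc]

theorem IsUnitaryMultiplier.preservesGram_iff {c β : ℂ → ℂ} (h : IsUnitaryMultiplier c β)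
    (hm : MapsTo β halfPlane halfPlane) :
    PreservesGram c β ↔ ∀ s ∈ halfPlane, ∀ t ∈ halfPlane,
      conj (halfPlaneToDisc (β 0) (β s)) * halfPlaneToDisc (β 0) (β t) =
        conj (halfPlaneToDisc 0 s) * halfPlaneToDisc 0 t := by
  have h0 := zero_mem_halfPlane
  have hb := hm h0
  refine forall₂_congr fun s hs => forall₂_congr fun t ht => ?_
  have h1 : conj (1 + s) ≠ 0 := (map_ne_zero _).2 (one_add_ne_zero_of_mem_halfPlane hs)
  have h2 := one_add_ne_zero_of_mem_halfPlane ht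
  have h3 : conj (1 + conj (β 0) + β s) ≠ 0 :=
    (map_ne_zero _).2 (one_add_conj_add_ne_zero hb (hm hs))
  have h4 := one_add_conj_add_ne_zero hb (hm ht)
  have h5 := one_add_conj_add_ne_zero hb hb
  -- Subtracting both sides from `1` turns the products into kernels, and the factors cancel against
  -- those of `conj (c s) * c t`.
  rw [← sub_right_inj (a := (1 : ℂ)) (b := conj (halfPlaneToDisc _ _) * _), one_sub_conj_halfPlaneToDisc_mul hb (hm hs) (hm ht),
    one_sub_conj_halfPlaneToDisc_mul h0 hs ht, h.conj_mul hb hs ht]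
  simp only [map_zero, add_zero, one_mul]
  rw [div_mul_eq_mul_div, div_eq_iff (mul_ne_zero h5 (mul_ne_zero h1 h2)),
    div_eq_div_iff (mul_ne_zero h3 h4) (mul_ne_zero h1 h2)]
  constructor <;> intro e <;> linear_combination -e

theorem PreservesGram.isHalfPlaneAutomorphism {c β : ℂ → ℂ} (h : PreservesGram c β)
    (hm : MapsTo β halfPlane halfPlane) : IsHalfPlaneAutomorphism β := by
  have hφ := ((h.isUnitaryMultiplier hm).preservesGram_iff hm).1 h
  -- The variable is frozen at `1`; `0` would not do, because `φ_0` vanishes there.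
  have h1 : (1 : ℂ) ∈ halfPlane := by simpa using natCast_mem_halfPlane 1
  have hφ1 : halfPlaneToDisc 0 1 = 1 / 2 := by
    norm_num [halfPlaneToDisc]
  set w := halfPlaneToDisc (β 0) (β 1) with hw
  have hw1 := hφ 1 h1 1 h1
  rw [hφ1, ← hw, Complex.conj_mul', Complex.conj_mul'] at hw1
  have hw2 : ‖w‖ = 1 / 2 := by
    have : ‖w‖ ^ 2 = (1 / 2) ^ 2 := by
      apply Complex.ofReal_injective
      push_cast
      rw [hw1]
      norm_num
    exact (sq_eq_sq₀ (norm_nonneg _) (by norm_num)).1 this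
  have hw0 : conj w ≠ 0 := (map_ne_zero _).2 (norm_ne_zero_iff.1 (by rw [hw2]; norm_num))
  -- The frozen identity reads `conj w * φ_b (β s) = φ_0 s / 2`, which dictates the rotation factor.
  refine isHalfPlaneAutomorphism_of_halfPlaneToDisc_eq (l := 1 / (2 * conj w)) ?_ hm
    fun s hs => ?_
  · rw [norm_div, norm_mul, RCLike.norm_conj, hw2]
    norm_num
  · have := hφ 1 h1 s hs
    rw [hφ1] at this
    simp only [map_div₀, map_one, map_ofNat] at this
    field_simp
    linear_combination 2 * this

theorem preservesGram_of_isHalfPlaneAutomorphism {c β : ℂ → ℂ}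
    (hβ : IsHalfPlaneAutomorphism β) (hc : IsUnitaryMultiplier c β) : PreservesGram c β := by
  rw [hc.preservesGram_iff hβ.2.1]
  obtain ⟨l, hl, h⟩ := hβ.exists_halfPlaneToDisc_eq
  have hl' : conj l * l = 1 := by simp [Complex.conj_mul', hl]
  intro s hs t ht
  rw [h s hs, h t ht, map_mul, mul_mul_mul_comm, hl', one_mul]

/-! ### From the Gram identity to operators -/

theorem actsOnMonomials_iff {T : L2Unit →L[ℂ] L2Unit} {c β : ℂ → ℂ}
    (hm : MapsTo β halfPlane halfPlane) :
    ActsOnMonomials T c β ↔ ∀ (s : ℂ) (hs : s ∈ halfPlane),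
      T (monomialL2 s hs) = c s • monomialL2 (β s) (hm hs) := by
  refine forall₂_congr fun s hs => ?_
  have h : ((c s • monomialL2 (β s) (hm hs) : L2Unit) : ℝ → ℂ) =ᵐ[unitIntervalMeasure]
      fun x => c s * monomialFun (β s) x := by
    filter_upwards [Lp.coeFn_smul (c s) (monomialL2 (β s) (hm hs)), coeFn_monomialL2 (hm hs)]
      with x h1 h2
    rw [h1, Pi.smul_apply, h2, smul_eq_mul]
  exact ⟨fun h1 => Lp.ext (h1.trans h.symm), fun h1 => by rwa [h1]⟩

/-- Injectivity excludes `c s = 0`, so dividing by `c s` shows that `x ^ β(s)` is itself in `L²`. -/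
theorem ActsOnMonomials.mapsTo {T : L2Unit →L[ℂ] L2Unit} {c β : ℂ → ℂ}
    (h : ActsOnMonomials T c β) (hT : Function.Injective T) :
    MapsTo β halfPlane halfPlane := by
  intro s hs
  have h1 := h s hs
  have hc : c s ≠ 0 := by
    intro hc
    refine monomialL2_ne_zero hs ((map_eq_zero_iff T hT).1 (Lp.ext ?_))
    filter_upwards [h1, Lp.coeFn_zero ℂ 2 unitIntervalMeasure] with x hx hx0
    rw [hx, hx0, hc, zero_mul, Pi.zero_apply]
  refine mem_halfPlane_of_memLp ?_
  have h2 := ((memLp_congr_ae h1).1 (Lp.memLp _)).const_mul (c s)⁻¹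
  simpa [hc] using h2

theorem ActsOnMonomials.preservesGram {T : L2Unit →L[ℂ] L2Unit} {c β : ℂ → ℂ}
    (h : ActsOnMonomials T c β) (hm : MapsTo β halfPlane halfPlane)
    (hT : ∀ f g, inner ℂ (T f) (T g) = inner ℂ f g) : PreservesGram c β := by
  intro s hs t ht
  have h1 := hT (monomialL2 s hs) (monomialL2 t ht)
  rw [(actsOnMonomials_iff hm).1 h, (actsOnMonomials_iff hm).1 h, inner_smul_left,
    inner_smul_right, inner_monomialL2, inner_monomialL2] at h1
  have h2 := one_add_conj_add_ne_zero hs ht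
  have h3 := one_add_conj_add_ne_zero (hm hs) (hm ht)
  field_simp at h1
  linear_combination h1

theorem denseRange_linearCombination_of_span {ι : Type*} {v : ι → L2Unit}
    (h : (Submodule.span ℂ (range v)).topologicalClosure = ⊤) :
    DenseRange (Finsupp.linearCombination ℂ v) := by
  rw [DenseRange, ← LinearMap.coe_range, Finsupp.range_linearCombination]
  exact Submodule.dense_iff_topologicalClosure_eq_top.2 h

theorem exists_unitary_actsOnMonomials {c β : ℂ → ℂ} (hβ : IsHalfPlaneAutomorphism β)
    (hc : IsUnitaryMultiplier c β) :
    ∃ T : L2Unit →L[ℂ] L2Unit,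
      ActsOnMonomials T c β ∧ T ∈ unitary (L2Unit →L[ℂ] L2Unit) := by
  have hg := preservesGram_of_isHalfPlaneAutomorphism hβ hc
  have hm := hβ.2.1
  obtain ⟨-, -, γ, -, hγm, -, hr⟩ := hβ
  set u : halfPlane → L2Unit := fun s => monomialL2 s s.2 with hu
  set v : halfPlane → L2Unit := fun s => c s • monomialL2 (β s) (hm s.2) with hv
  have hinner : ∀ s t, inner ℂ (v s) (v t) = inner ℂ (u s) (u t) := fun s t => by
    simp only [hu, hv]
    rw [inner_smul_left, inner_smul_right, inner_monomialL2, inner_monomialL2]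
    have h2 := one_add_conj_add_ne_zero s.2 t.2
    have h3 := one_add_conj_add_ne_zero (hm s.2) (hm t.2)
    have := hg s s.2 t t.2
    field_simp
    linear_combination this
  have hnorm : ∀ x, ‖Finsupp.linearCombination ℂ v (LinearEquiv.refl ℂ (halfPlane →₀ ℂ) x)‖ =
      ‖Finsupp.linearCombination ℂ u x‖ := fun x => by
    rw [LinearEquiv.refl_apply, ← sq_eq_sq₀ (norm_nonneg _) (norm_nonneg _),
      ← Complex.ofReal_inj]
    push_cast
    have key := fun w : L2Unit => inner_self_eq_norm_sq_to_K (𝕜 := ℂ) w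
    simp only [Complex.coe_algebraMap] at key
    rw [← key, ← key, Finsupp.linearCombination_apply, Finsupp.linearCombination_apply]
    simp only [Finsupp.sum, sum_inner, inner_sum, inner_smul_left, inner_smul_right, hinner]
  have hdu : DenseRange (Finsupp.linearCombination ℂ u) :=
    denseRange_linearCombination_of_span topologicalClosure_span_monomialL2
  have hdv : DenseRange (Finsupp.linearCombination ℂ v) := by
    refine denseRange_linearCombination_of_span (top_unique ?_)
    rw [← topologicalClosure_span_monomialL2]
    refine Submodule.topologicalClosure_mono (Submodule.span_le.2 ?_)
    rintro _ ⟨s, rfl⟩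
    -- Each monomial is a scalar multiple of the image vector at `γ s`; the diagonal of the Gram
    -- identity shows `c (γ s) ≠ 0`.
    have hγ := hγm s.2
    have hcne : c (γ s) ≠ 0 := by
      intro h0
      have := hg _ hγ _ hγ
      rw [h0, mul_zero, zero_mul] at this
      exact one_add_conj_add_ne_zero (hm hγ) (hm hγ) this.symm
    have hs : monomialL2 (β (γ s)) (hm hγ) = monomialL2 s s.2 := by
      congr 1
      exact hr s.2
    have hmem : v ⟨γ s, hγ⟩ ∈ Submodule.span ℂ (range v) := Submodule.subset_span ⟨_, rfl⟩
    have := Submodule.smul_mem _ (c (γ s))⁻¹ hmem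
    simp only [hv] at this
    rwa [inv_smul_smul₀ hcne, hs] at this
  -- Coefficient vectors map densely into `L²` through both `u` and `v`, with equal norms, so the
  -- identity on coefficients extends to a surjective isometry taking `u s` to `v s`.
  set e := (LinearEquiv.refl ℂ (halfPlane →₀ ℂ)).extendOfIsometry _ _ hdu hdv hnorm
  refine ⟨_, (actsOnMonomials_iff hm).2 fun s hs => ?_,
    (Unitary.linearIsometryEquiv.symm e).2⟩
  have h1 := LinearEquiv.extendOfIsometry_eq (LinearEquiv.refl ℂ (halfPlane →₀ ℂ)) _ _ hdu hdv
    hnorm (Finsupp.single ⟨s, hs⟩ 1)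
  rw [LinearEquiv.refl_apply, Finsupp.linearCombination_single,
    Finsupp.linearCombination_single, one_smul, one_smul] at h1
  exact h1

/-- By density, a given operator must coincide with the unitary one constructed above; this yields
the second half of the theorem. -/
theorem ActsOnMonomials.unique {S T : L2Unit →L[ℂ] L2Unit} {c β : ℂ → ℂ}
    (hS : ActsOnMonomials S c β) (hT : ActsOnMonomials T c β) : S = T := by
  refine ContinuousLinearMap.ext_on
    (Submodule.dense_iff_topologicalClosure_eq_top.2 topologicalClosure_span_monomialL2) ?_
  rintro _ ⟨s, rfl⟩
  exact Lp.ext ((hS s s.2).trans (hT s s.2).symm)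

theorem ActsOnMonomials.condition_of_unitary {T : L2Unit →L[ℂ] L2Unit} {c β : ℂ → ℂ}
    (h : ActsOnMonomials T c β) (hT : T ∈ unitary (L2Unit →L[ℂ] L2Unit)) :
    IsHalfPlaneAutomorphism β ∧ IsUnitaryMultiplier c β := by
  have hinner : ∀ f g, inner ℂ (T f) (T g) = inner ℂ f g :=
    (Unitary.linearIsometryEquiv ⟨T, hT⟩).inner_map_map
  have hm := h.mapsTo (Unitary.linearIsometryEquiv ⟨T, hT⟩).injective
  have hg := h.preservesGram hm hinner
  exact ⟨hg.isHalfPlaneAutomorphism hm, hg.isUnitaryMultiplier hm⟩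

end

theorem mainTheorem5 (c β : ℂ → ℂ) :
    ((∃ T : L2Unit →L[ℂ] L2Unit,
        ActsOnMonomials T c β ∧ T ∈ unitary (L2Unit →L[ℂ] L2Unit)) ↔
      (IsHalfPlaneAutomorphism β ∧ IsUnitaryMultiplier c β)) ∧
    (∀ T : L2Unit →L[ℂ] L2Unit, ActsOnMonomials T c β →
      (T ∈ unitary (L2Unit →L[ℂ] L2Unit) ↔
        (IsHalfPlaneAutomorphism β ∧ IsUnitaryMultiplier c β))) := by
  refine ⟨⟨fun ⟨T, h, hT⟩ => h.condition_of_unitary hT,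
    fun h => exists_unitary_actsOnMonomials h.1 h.2⟩,
    fun T h => ⟨h.condition_of_unitary, fun hc => ?_⟩⟩
  obtain ⟨S, hS, hSu⟩ := exists_unitary_actsOnMonomials hc.1 hc.2
  rwa [h.unique hS]
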